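/- **Theorem 3.1.** Let $R$ be an associative ring with unit and let $S=\begin{pmatrix}A&B\\ C&D\end{pmatrix}$ be a switch over $R$, that is, an invertible $2\times2$ matrix with entries in $R$ satisfying the Yang–Baxter equation $(S\times 1)(1\times S)(S\times 1)=(1\times S)(S\times 1)(1\times S)$ of $3\times 3$ matrices, where $S\times 1=\begin{pmatrix}A&B&0\\ C&D&0\\ 0&0&1\end{pmatrix}$ and $1\times S=\begin{pmatrix}1&0&0\\ 0&A&B\\ 0&C&D\end{pmatrix}$. (The universal case is the switch with entries $A$, $B$, $C=A^{-1}B^{-1}A(1-A)$, $D=1-A^{-1}B^{-1}AB$ over the fundamental algebra generated by invertible $A,B$ with the relation $A^{-1}B^{-1}AB-B^{-1}AB=BA^{-1}B^{-1}A-A$, with $1-A$ inverted.) Suppose that $A$, $1-A$ and $B$ are invertible in $R$. A long virtual knot diagram is an oriented long curve in the plane with finitely many transverse double points, each marked as a positive, a negative or a virtual crossing. Let $x_0,x_1,\dots,x_n$ be its semi-arcs, in the order in which they appear along the curve; a new semi-arc begins at each passage through a real (positive or negative) crossing, and virtual crossings do not change the label. Let $\mathcal M$ be the left $R$-module generated by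 $x_0,\dots,x_n$ with the following two relations for each real crossing. Write $o,o'$ for the incoming and outgoing semi-arcs of the over strand and $u,u'$ for the incoming and outgoing semi-arcs of the under strand; the relations are $$u'=Ao+Bu,\quad o'=Co+Du\quad\text{at a positive crossing},$$ $$u=Ao'+Bu',\quad o=Co'+Du'\quad\text{at a negative crossing}.$$ Let $\widehat{\mathcal M}$, $\overset{o}{\mathcal M}$ and $\overset{n}{\mathcal M}$ be the quotients of $\mathcal M$ by the additional relation $x_0=x_n$, $x_0=0$ and $x_n=0$ respectively. If two long virtual knot diagrams are related by a finite sequence of generalized Reidemeister moves (the real moves of types I, II, III, the virtual moves of types I, II, III, and the mixed move of type III with one real and two virtual crossings, with all orientations and signs), then their modules $\mathcal M$ are isomorphic as left $R$-modules, and so are their modules $\widehat{\mathcal M}$, their modules $\overset{o}{\mathcal M}$ and their modules $\overset{n}{\mathcal M}$. Thus the four modules are invariants $\mathcal M_K$, $\widehat{\mathcal M}_K$, $\overset{o}{\mathcal M}_K$, $\overset{n}{\mathcal M}_K$ of the long virtual knot $K$. -/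

import Mathlib

namespace LongVirtual

/-! ### Long virtual knot diagrams

A long virtual knot diagram is a generic oriented long curve in the plane, each of whose double
points is a positive crossing, a negative crossing or a virtual crossing. Up to planar isotopy it is
recorded by the sequence of passages through crossings that one meets along the curve; every
crossing is passed twice. A passage records the strand that is being followed (over, under, or
virtual) and the direction in which the other strand traverses it, so that the sequence determines
the cyclic order of the four edges at every crossing. Such a sequence comes from a diagram in the
plane exactly when the surface it determines has genus zero, see `IsPlanar`. -/

inductive Level where
  | over
  | under
  | virt

def Level.swap : Level → Level
  | .over => .under
  | .under => .over
  | .virt => .virt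

/-- One passage of the curve through a crossing. -/
structure Passage where
  /-- the name of the crossing -/
  label : ℕ
  /-- whether the strand followed is the over strand, the under strand, or the crossing is virtual -/
  level : Level
  /-- `true` if the other strand goes from the right to the left of the strand followed,
  `false` if it goes from the left to the right -/
  side : Bool

/-- The passage of the other strand through the same crossing. -/
def Passage.partner (p : Passage) : Passage := ⟨p.label, p.level.swap, !p.side⟩

/-- The passage through the same crossing under a new name. -/
def Passage.rename (f : ℕ → ℕ) (p : Passage) : Passage := ⟨f p.label, p.level, p.side⟩

/-- Is the crossing a real (that is, not a virtual) one? -/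
def Passage.isReal (p : Passage) : Bool :=
  match p.level with
  | .virt => false
  | _ => true

/-- Every crossing that occurs is passed exactly twice, in two complementary passages. -/
structure IsCode (w : List Passage) : Prop where
  nodup : w.Nodup
  partner_mem : ∀ p ∈ w, p.partner ∈ w
  eq_or_eq_partner : ∀ p ∈ w, ∀ q ∈ w, q.label = p.label → q = p ∨ q = p.partner

/-- The edges of the underlying curve: edge `k` runs from the `k`-th passage (from infinity, if
`k = 0`) to the next one (to infinity, for the last edge). A dart is an edge with a direction,
`true` being the orientation of the curve. -/
abbrev Dart (w : List Passage) : Type := Fin (w.length + 1) × Bool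

/-- Walking along the boundary of the face on one's left: at the end of a dart one turns left. The
two ends of the long curve are joined at the point at infinity of the sphere. -/
inductive FaceStep (w : List Passage) : Dart w → Dart w → Prop
  | forward_left (i j : Fin w.length) (h : w[j] = w[i].partner) (hs : w[i].side = true) :
      FaceStep w (i.castSucc, true) (j.succ, true)
  | forward_right (i j : Fin w.length) (h : w[j] = w[i].partner) (hs : w[i].side = false) :
      FaceStep w (i.castSucc, true) (j.castSucc, false)
  | backward_left (i j : Fin w.length) (h : w[j] = w[i].partner) (hs : w[i].side = true) :
      FaceStep w (i.succ, false) (j.castSucc, false)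
  | backward_right (i j : Fin w.length) (h : w[j] = w[i].partner) (hs : w[i].side = false) :
      FaceStep w (i.succ, false) (j.succ, true)
  | infinity_forward : FaceStep w (Fin.last w.length, true) (0, true)
  | infinity_backward : FaceStep w (0, false) (Fin.last w.length, false)

/-- The faces: the classes of darts under the equivalence relation generated by `FaceStep`. -/
abbrev Face (w : List Passage) : Type := Quot (FaceStep w)

/-- The genus is zero. With `c` crossings, the word has length `2 * c`; counting the point at
infinity there are `c + 1` vertices and `2 * c + 1` edges, so that Euler's formula asks for `c + 2`
faces. -/
def IsPlanar (w : List Passage) : Prop := 2 * Nat.card (Face w) = w.length + 4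

/-- A long virtual knot diagram, up to planar isotopy. -/
structure Diagram where
  word : List Passage
  isCode : IsCode word
  isPlanar : IsPlanar word

/-! ### Generalized Reidemeister moves -/

/-- Two passages in one order or the other. -/
def ordered (b : Bool) (p q : Passage) : List Passage := if b then [p, q] else [q, p]

/-- The three strands 1, 2, 3 cross pairwise; `a`, `b`, `c` are the levels of strand 1 at its
crossing with 2, of strand 1 at its crossing with 3, and of strand 2 at its crossing with 3.
A move of the third kind is permitted if two of the crossings are virtual (so that one strand is
virtual at both of its crossings; the third crossing is real or virtual), or if all three
are real and the three strands lie at different heights. Excluded are exactly one virtual crossing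
and the cyclic cases `1 > 2 > 3 > 1` and `1 < 2 < 3 < 1`. -/
def AllowedTriple (a b c : Level) : Prop :=
  (a = .virt ∧ b = .virt) ∨ (a = .virt ∧ c = .virt) ∨ (b = .virt ∧ c = .virt) ∨
    (a ≠ .virt ∧ b ≠ .virt ∧ c ≠ .virt ∧ ¬ (a = c ∧ b ≠ a))

/-- The generalized Reidemeister moves, each in one direction. -/
inductive Move : List Passage → List Passage → Prop
  /-- The names of the crossings do not matter. -/
  | rename (f : ℕ → ℕ) (hf : Function.Injective f) (w : List Passage) :
      Move w (w.map (Passage.rename f))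
  /-- First move, real or virtual, with every sign and orientation: a kink. -/
  | kink (u v : List Passage) (p : Passage) : Move (u ++ v) (u ++ [p, p.partner] ++ v)
  /-- Second move, real or virtual, for two strands that run in the same direction: one strand
  is over, under, or virtual at both of the new crossings and is crossed in opposite directions. -/
  | bigon_parallel (u v w : List Passage) (p q : Passage)
      (hlevel : q.level = p.level) (hside : q.side = !p.side) :
      Move (u ++ v ++ w) (u ++ [p, q] ++ v ++ [p.partner, q.partner] ++ w)
  /-- Second move for two strands that run in opposite directions. -/
  | bigon_antiparallel (u v w : List Passage) (p q : Passage)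
      (hlevel : q.level = p.level) (hside : q.side = !p.side) :
      Move (u ++ v ++ w) (u ++ [p, q] ++ v ++ [q.partner, p.partner] ++ w)
  /-- Third move, real, virtual or mixed. Here `a` and `b` are the passages of the first strand
  through its crossings with the second and the third strand, `c` is the passage of the
  second strand through its crossing with the third. Three oriented lines in general position with
  given crossing directions are in one of two positions, told apart by the bit `d`, which
  determine the order of the two crossings on each line; the move goes from one to the other. -/
  | triangle (u v w z : List Passage) (a b c : Passage) (d : Bool)
      (h : AllowedTriple a.level b.level c.level) :
      Move
        (u ++ ordered (d ^^ a.side ^^ b.side) a b ++ v ++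
          ordered (d ^^ a.side ^^ c.side) a.partner c ++ w ++
          ordered (d ^^ b.side ^^ c.side) b.partner c.partner ++ z)
        (u ++ ordered (!d ^^ a.side ^^ b.side) a b ++ v ++
          ordered (!d ^^ a.side ^^ c.side) a.partner c ++ w ++
          ordered (!d ^^ b.side ^^ c.side) b.partner c.partner ++ z)

/-- Two diagrams represent the same long virtual knot if they are related by a finite sequence of
generalized Reidemeister moves and their inverses. -/
def Diagram.Equivalent : Diagram → Diagram → Prop :=
  Relation.EqvGen fun D E => Move D.word E.word

/-! ### Switches -/

section Switch

variable {R : Type*} [Ring R]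

/-- The matrix `S × 1`. -/
def leftFactor (S : Matrix (Fin 2) (Fin 2) R) : Matrix (Fin 3) (Fin 3) R :=
  !![S 0 0, S 0 1, 0; S 1 0, S 1 1, 0; 0, 0, 1]

/-- The matrix `1 × S`. -/
def rightFactor (S : Matrix (Fin 2) (Fin 2) R) : Matrix (Fin 3) (Fin 3) R :=
  !![1, 0, 0; 0, S 0 0, S 0 1; 0, S 1 0, S 1 1]

/-- A switch is an invertible `2 × 2` matrix that satisfies the set theoretic Yang-Baxter
equation. -/
structure IsSwitch (S : Matrix (Fin 2) (Fin 2) R) : Prop where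
  isUnit : IsUnit S
  yangBaxter : leftFactor S * rightFactor S * leftFactor S =
    rightFactor S * leftFactor S * rightFactor S

end Switch

/-! ### The four modules -/

/-- The number of passages through real crossings; the semi-arcs are `x₀, …, xₙ` with `n` this
number. -/
def Diagram.n (D : Diagram) : ℕ := D.word.countP Passage.isReal

/-- The semi-arc that contains the edge `k`: labels change at real crossings only. -/
def Diagram.arc (D : Diagram) (k : Fin (D.word.length + 1)) : Fin (D.n + 1) :=
  ⟨(D.word.take k).countP Passage.isReal,
    Nat.lt_succ_of_le (List.Sublist.countP_le (List.take_sublist _ _))⟩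

section Modules

variable {R : Type*} [Ring R] (S : Matrix (Fin 2) (Fin 2) R) (D : Diagram)

/-- The generator attached to the semi-arc that contains the edge `k`. -/
noncomputable def Diagram.gen (k : Fin (D.word.length + 1)) : Fin (D.n + 1) →₀ R :=
  Finsupp.single (D.arc k) 1

/-- The relators of the real crossings. The over strand enters and leaves at `i.castSucc` and
`i.succ`, the under strand at `j.castSucc` and `j.succ`; the crossing is positive if the under
strand goes from the right to the left of the over strand. The relations are
`S (over in, under in) = (under out, over out)` at a positive crossing and
`S (over out, under out) = (under in, over in)` at a negative one. -/
inductive Diagram.Relator : (Fin (D.n + 1) →₀ R) → Prop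
  | pos_under (i j : Fin D.word.length) (h : D.word[j] = D.word[i].partner)
      (ho : D.word[i].level = .over) (hs : D.word[i].side = true) :
      Diagram.Relator
        (S 0 0 • D.gen i.castSucc + S 0 1 • D.gen j.castSucc - D.gen j.succ)
  | pos_over (i j : Fin D.word.length) (h : D.word[j] = D.word[i].partner)
      (ho : D.word[i].level = .over) (hs : D.word[i].side = true) :
      Diagram.Relator
        (S 1 0 • D.gen i.castSucc + S 1 1 • D.gen j.castSucc - D.gen i.succ)
  | neg_under (i j : Fin D.word.length) (h : D.word[j] = D.word[i].partner)
      (ho : D.word[i].level = .over) (hs : D.word[i].side = false) :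
      Diagram.Relator
        (S 0 0 • D.gen i.succ + S 0 1 • D.gen j.succ - D.gen j.castSucc)
  | neg_over (i j : Fin D.word.length) (h : D.word[j] = D.word[i].partner)
      (ho : D.word[i].level = .over) (hs : D.word[i].side = false) :
      Diagram.Relator
        (S 1 0 • D.gen i.succ + S 1 1 • D.gen j.succ - D.gen i.castSucc)

/-- The submodule of relations. -/
noncomputable def Diagram.relations : Submodule R (Fin (D.n + 1) →₀ R) :=
  Submodule.span R {r | D.Relator S r}

/-- The left module with generators `x₀, …, xₙ` and the relations of the real crossings. -/
abbrev Diagram.KnotModule : Type _ := (Fin (D.n + 1) →₀ R) ⧸ D.relations S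

/-- The generator `xᵢ` in the module. -/
noncomputable def Diagram.x (i : Fin (D.n + 1)) : D.KnotModule S :=
  (D.relations S).mkQ (Finsupp.single i 1)

/-- The quotient by the additional relation `x₀ = xₙ`. -/
abbrev Diagram.ClosureModule : Type _ :=
  D.KnotModule S ⧸ Submodule.span R {D.x S 0 - D.x S (Fin.last D.n)}

/-- The quotient by the additional relation `x₀ = 0`. -/
abbrev Diagram.InputModule : Type _ :=
  D.KnotModule S ⧸ Submodule.span R {D.x S 0}

/-- The quotient by the additional relation `xₙ = 0`. -/
abbrev Diagram.OutputModule : Type _ :=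
  D.KnotModule S ⧸ Submodule.span R {D.x S (Fin.last D.n)}

end Modules

end LongVirtual

/-! Colour the edges of a diagram by elements of a left `R`-module `N`, imposing the crossing
relations of the switch. Such a colouring is the same thing as a linear map from the knot module to
`N`, with `x₀` and `xₙ` going to the first and last colours. So the knot module carries a universal
colouring, and it suffices to carry colourings across each move with the end colours fixed.

For this only the biquandle axioms matter. `isBiquandle_of_isSwitch` derives them: invertibility of
`S`, `B` and `C` allows colours to be propagated through a crossing in every direction, the
Yang–Baxter equation gives the third move, and two of its entries give the diagonal condition behind
the first move. Invertibility of `C` follows from that of `A`, `1 - A` and `B`.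

`Move.exists_transfer` packages each move as a `Transfer`: existence of a corresponding colouring in
both directions, and its uniqueness once enough colours are recorded. In `endIso_of_transfer` the
transferred universal colourings yield linear maps both ways between the two knot modules. A linear
image of a colouring is a colouring, so uniqueness forces the maps to be mutually inverse. They
match the two end generators, hence descend to all the quotients. -/

namespace LongVirtual

/-! ### Colourings of a single crossing and of a triangle -/

section Local

variable {N : Type*}

/-- The operations of a biquandle: at a positive crossing with incoming colours `o` and `u` on the
over and the under strand, `f o u` is the outgoing colour of the under strand and `g o u` that of
the over strand. -/
structure IsBiquandle (f g : N → N → N) : Prop where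
  pair_injective : ∀ o u o' u', f o u = f o' u' → g o u = g o' u' → o = o' ∧ u = u'
  pair_surjective : ∀ a b, ∃ o u, f o u = a ∧ g o u = b
  f_bijective : ∀ o, Function.Bijective (f o)
  g_bijective : ∀ u, Function.Bijective fun o => g o u
  diagonal : ∀ o u, g o u = u ↔ f o u = o
  yangBaxter_low : ∀ x y z, f (f x y) (f (g x y) z) = f x (f y z)
  yangBaxter_middle : ∀ x y z, g (f x y) (f (g x y) z) = f (g x (f y z)) (g y z)
  yangBaxter_high : ∀ x y z, g (g x y) z = g (g x (f y z)) (g y z)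

/-- The relation at a crossing between the pairs (incoming colour, outgoing colour) of a
strand of the given level and side and of the other strand. -/
def Crossing (f g : N → N → N) : Level → Bool → N × N → N × N → Prop
  | .over, true, s, t => t.2 = f s.1 t.1 ∧ s.2 = g s.1 t.1
  | .over, false, s, t => t.1 = f s.2 t.2 ∧ s.1 = g s.2 t.2
  | .under, true, s, t => s.1 = f t.2 s.2 ∧ t.1 = g t.2 s.2
  | .under, false, s, t => s.2 = f t.1 s.1 ∧ t.2 = g t.1 s.1
  | .virt, _, s, t => s.1 = s.2 ∧ t.1 = t.2

variable {f g : N → N → N}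

theorem Level.swap_swap (l : Level) : l.swap.swap = l := by cases l <;> rfl

theorem crossing_swap (l : Level) (b : Bool) (s t : N × N) :
    Crossing f g l.swap (!b) t s ↔ Crossing f g l b s t := by
  cases l <;> cases b <;> simp [Crossing, Level.swap, and_comm]

/-- The negative relation is the positive one with incoming and outgoing colours exchanged on both
strands. This symmetry halves the case analysis for triangles. -/
theorem crossing_reverse (l : Level) (b : Bool) (s t : N × N) :
    Crossing f g l (!b) s.swap t.swap ↔ Crossing f g l b s t := by
  cases l <;> cases b <;> simp [Crossing, eq_comm]

/-- A kink feeds an outgoing colour of the crossing back in as an incoming one; this is exactly the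
situation of the diagonal axiom. -/
theorem Crossing.kink_eq (h : IsBiquandle f g) {l : Level} {b : Bool} {x y z : N}
    (hc : Crossing f g l b (x, y) (y, z)) : z = x := by
  have := h.diagonal
  cases l <;> cases b <;> simp only [Crossing] at hc <;> grind

theorem Crossing.kink_unique (h : IsBiquandle f g) {l : Level} {b : Bool} {x y y' : N}
    (hc : Crossing f g l b (x, y) (y, x)) (hc' : Crossing f g l b (x, y') (y', x)) : y = y' := by
  have hf := fun o => (h.f_bijective o).1
  have hg := fun u => (h.g_bijective u).1
  have := h.diagonal
  cases l <;> cases b <;> simp only [Crossing, Function.Injective] at hc hc' hf hg <;> grind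

theorem exists_kink (h : IsBiquandle f g) (l : Level) (b : Bool) (x : N) :
    ∃ y, Crossing f g l b (x, y) (y, x) := by
  obtain ⟨y, hy⟩ := (h.f_bijective x).2 x
  obtain ⟨z, hz⟩ := (h.g_bijective x).2 x
  have hy' := (h.diagonal x y).2 hy
  have hz' := (h.diagonal z x).1 hz
  simp only at hz
  cases l <;> cases b
  · exact ⟨z, hz'.symm, hz.symm⟩
  · exact ⟨y, hy.symm, hy'.symm⟩
  · exact ⟨z, hz'.symm, hz.symm⟩
  · exact ⟨y, hy.symm, hy'.symm⟩
  all_goals exact ⟨x, by simp [Crossing]⟩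

/-- The part of a strand from `x` via `y` to `z` that lies at the first or the second of its two
crossings. -/
def seg (b : Bool) (x y z : N) : N × N := if b then (x, y) else (y, z)

theorem seg_swap (b : Bool) (x y z : N) : (seg b x y z).swap = seg (!b) z y x := by
  cases b <;> rfl

/-- The two crossings of a bigon, where `e` tells whether the strands run in the same direction. -/
def Bigon (f g : N → N → N) (l : Level) (b e : Bool) (x₀ x₁ x₂ y₀ y₁ y₂ : N) : Prop :=
  Crossing f g l b (x₀, x₁) (seg e y₀ y₁ y₂) ∧ Crossing f g l (!b) (x₁, x₂) (seg (!e) y₀ y₁ y₂)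

/-- The two crossings undo each other. For parallel real strands this is injectivity of the pair
map; for antiparallel ones the crossings share a colour on each strand, and `f` or `g` with one
argument fixed is cancelled. -/
theorem Bigon.eq (h : IsBiquandle f g) {l : Level} {b e : Bool} {x₀ x₁ x₂ y₀ y₁ y₂ : N}
    (hb : Bigon f g l b e x₀ x₁ x₂ y₀ y₁ y₂) : x₂ = x₀ ∧ y₂ = y₀ := by
  have hf := fun o => (h.f_bijective o).1
  have hg := fun u => (h.g_bijective u).1
  have hp := h.pair_injective
  cases l <;> cases b <;> cases e <;>
    simp [Bigon, Crossing, seg, Function.Injective] at hb hf hg <;> grind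

theorem Bigon.unique (h : IsBiquandle f g) {l : Level} {b e : Bool} {x y x₁ y₁ x₁' y₁' : N}
    (hb : Bigon f g l b e x x₁ x y y₁ y) (hb' : Bigon f g l b e x x₁' x y y₁' y) :
    x₁ = x₁' ∧ y₁ = y₁' := by
  have hf := fun o => (h.f_bijective o).1
  have hg := fun u => (h.g_bijective u).1
  have hp := h.pair_injective
  cases l <;> cases b <;> cases e <;>
    simp [Bigon, Crossing, seg, Function.Injective] at hb hb' hf hg <;> grind

theorem exists_bigon (h : IsBiquandle f g) (l : Level) (b e : Bool) (x y : N) :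
    ∃ x₁ y₁, Bigon f g l b e x x₁ x y y₁ y := by
  have hf := fun o => (h.f_bijective o).2
  have hg := fun u => (h.g_bijective u).2
  have hp := h.pair_surjective
  obtain ⟨p₁, p₂, hp₁, hp₂⟩ := hp x y
  obtain ⟨q₁, q₂, hq₁, hq₂⟩ := hp y x
  obtain ⟨r, hr⟩ := hf x y
  obtain ⟨s, hs⟩ := hf y x
  obtain ⟨t, ht⟩ := hg x y
  obtain ⟨v, hv⟩ := hg y x
  simp only at ht hv
  cases l <;> cases b <;> cases e <;> simp [Bigon, Crossing, seg] <;> grind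

/-- The three crossings of a triangle, see `Move.triangle`. -/
def Triangle (f g : N → N → N) (a b c : Level) (s t r d : Bool)
    (x₀ x₁ x₂ y₀ y₁ y₂ z₀ z₁ z₂ : N) : Prop :=
  Crossing f g a s (seg (d ^^ s ^^ t) x₀ x₁ x₂) (seg (d ^^ s ^^ r) y₀ y₁ y₂) ∧
  Crossing f g b t (seg (!(d ^^ s ^^ t)) x₀ x₁ x₂) (seg (d ^^ t ^^ r) z₀ z₁ z₂) ∧
  Crossing f g c r (seg (!(d ^^ s ^^ r)) y₀ y₁ y₂) (seg (!(d ^^ t ^^ r)) z₀ z₁ z₂)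

theorem triangle_reverse {a b c : Level} {s t r d : Bool} {x₀ x₁ x₂ y₀ y₁ y₂ z₀ z₁ z₂ : N} :
    Triangle f g a b c (!s) (!t) (!r) (!d) x₂ x₁ x₀ y₂ y₁ y₀ z₂ z₁ z₀ ↔
      Triangle f g a b c s t r d x₀ x₁ x₂ y₀ y₁ y₂ z₀ z₁ z₂ := by
  unfold Triangle
  rw [← crossing_reverse a s, ← crossing_reverse b t, ← crossing_reverse c r]
  simp [seg_swap]

/-- Renumbering the first two strands looks at their common crossing from the other strand, which
flips its side; flipping `d` as well keeps the order of crossings on every strand. -/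
theorem triangle_swap_first {a b c : Level} {s t r d : Bool}
    {x₀ x₁ x₂ y₀ y₁ y₂ z₀ z₁ z₂ : N} :
    Triangle f g a.swap c b (!s) r t (!d) y₀ y₁ y₂ x₀ x₁ x₂ z₀ z₁ z₂ ↔
      Triangle f g a b c s t r d x₀ x₁ x₂ y₀ y₁ y₂ z₀ z₁ z₂ := by
  unfold Triangle
  rw [← crossing_swap a s]
  have : (d ^^ r ^^ t) = (d ^^ t ^^ r) := by cases r <;> cases t <;> simp
  simp [and_comm, this]

theorem triangle_swap_last {a b c : Level} {s t r d : Bool}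
    {x₀ x₁ x₂ y₀ y₁ y₂ z₀ z₁ z₂ : N} :
    Triangle f g b a c.swap t s (!r) (!d) x₀ x₁ x₂ z₀ z₁ z₂ y₀ y₁ y₂ ↔
      Triangle f g a b c s t r d x₀ x₁ x₂ y₀ y₁ y₂ z₀ z₁ z₂ := by
  unfold Triangle
  rw [← crossing_swap c r]
  have : (d ^^ s ^^ t) = (d ^^ t ^^ s) := by cases s <;> cases t <;> simp
  simp [this, and_left_comm]

/-- Colours can be transported uniquely along the third moves with the given levels. -/
structure Slides (f g : N → N → N) (a b c : Level) : Prop where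
  exists_slide : ∀ {s t r d : Bool} {x₀ x₁ x₂ y₀ y₁ y₂ z₀ z₁ z₂ : N},
    Triangle f g a b c s t r d x₀ x₁ x₂ y₀ y₁ y₂ z₀ z₁ z₂ →
      ∃ x y z, Triangle f g a b c s t r (!d) x₀ x x₂ y₀ y y₂ z₀ z z₂
  unique : ∀ {s t r d : Bool} {x₀ x₁ x₂ y₀ y₁ y₂ z₀ z₁ z₂ x y z : N},
    Triangle f g a b c s t r d x₀ x₁ x₂ y₀ y₁ y₂ z₀ z₁ z₂ →
      Triangle f g a b c s t r d x₀ x x₂ y₀ y y₂ z₀ z z₂ → x₁ = x ∧ y₁ = y ∧ z₁ = z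

theorem Slides.swap_first {a b c : Level} (h : Slides f g a b c) : Slides f g a.swap c b where
  exists_slide {s t r d _ _ _ _ _ _ _ _ _} ht := by
    rw [← triangle_swap_first, Level.swap_swap] at ht
    obtain ⟨x, y, z, h'⟩ := h.exists_slide ht
    refine ⟨y, x, z, ?_⟩
    rw [← triangle_swap_first, Level.swap_swap]
    exact h'
  unique ht ht' := by
    rw [← triangle_swap_first, Level.swap_swap] at ht ht'
    obtain ⟨h₁, h₂, h₃⟩ := h.unique ht ht'
    exact ⟨h₂, h₁, h₃⟩

theorem Slides.swap_last {a b c : Level} (h : Slides f g a b c) : Slides f g b a c.swap where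
  exists_slide {s t r d _ _ _ _ _ _ _ _ _} ht := by
    rw [← triangle_swap_last, Level.swap_swap] at ht
    obtain ⟨x, y, z, h'⟩ := h.exists_slide ht
    refine ⟨x, z, y, ?_⟩
    rw [← triangle_swap_last, Level.swap_swap]
    exact h'
  unique ht ht' := by
    rw [← triangle_swap_last, Level.swap_swap] at ht ht'
    obtain ⟨h₁, h₂, h₃⟩ := h.unique ht ht'
    exact ⟨h₁, h₃, h₂⟩

theorem slides_virtual (c : Level) : Slides f g .virt .virt c where
  exists_slide {s t r d x₀ x₁ x₂ y₀ y₁ y₂ z₀ z₁ z₂} ht := by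
    -- The virtual strand keeps one colour. On each other strand the move exchanges a virtual
    -- crossing with crossing `c`, so the new middle colour is the final one if the virtual crossing
    -- used to come first, and the initial one otherwise.
    refine ⟨x₀, seg (d ^^ s ^^ r) y₂ y₀ y₀ |>.1, seg (d ^^ t ^^ r) z₂ z₀ z₀ |>.1, ?_⟩
    unfold Triangle at ht ⊢
    cases s <;> cases t <;> cases r <;> cases d <;> simp [Crossing, seg] at ht ⊢ <;>
      obtain ⟨⟨h₁, h₂⟩, ⟨h₃, h₄⟩, h₅⟩ := ht <;> subst_vars <;> simp_all
  unique {s t r d x₀ x₁ x₂ y₀ y₁ y₂ z₀ z₁ z₂ x y z} ht ht' := by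
    unfold Triangle at ht ht'
    cases s <;> cases t <;> cases r <;> cases d <;> simp [Crossing, seg] at ht ht' <;> grind

/-- Every orientation reduces to the Yang–Baxter identities for one triple of inputs. The
orientations decide which of these inputs are already present; a missing one is found by solving at
a crossing of the new triangle. -/
theorem exists_slide_of_positive (h : IsBiquandle f g) {t r d : Bool}
    {x₀ x₁ x₂ y₀ y₁ y₂ z₀ z₁ z₂ : N}
    (ht : Triangle f g .over .over .over true t r d x₀ x₁ x₂ y₀ y₁ y₂ z₀ z₁ z₂) :
    ∃ x y z, Triangle f g .over .over .over true t r (!d) x₀ x x₂ y₀ y y₂ z₀ z z₂ := by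
  have hf := fun o => (h.f_bijective o).1
  have hg := fun u => (h.g_bijective u).1
  have hp := h.pair_injective
  have h₁ := h.yangBaxter_low
  have h₂ := h.yangBaxter_middle
  have h₃ := h.yangBaxter_high
  unfold Triangle at ht ⊢
  cases t <;> cases r <;> cases d <;> simp [Crossing, seg, Function.Injective] at ht hf hg ⊢
  · obtain ⟨x, y, hx, hy⟩ := h.pair_surjective y₂ x₂
    have := h₁ x y z₂
    have := h₂ x y z₂
    have := h₃ x y z₂
    exact ⟨x, y, by grind⟩
  · have := h₁ x₁ y₁ z₂
    have := h₂ x₁ y₁ z₂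
    have := h₃ x₁ y₁ z₂
    grind
  -- The unknown `x` solves the new crossing of strands 1 and 3. Yang–Baxter then gives only an
  -- equality after applying `g · z₁`, which has to be cancelled to obtain the new crossing of
  -- strands 1 and 2. The next case is analogous with `f`.
  · obtain ⟨x, hx⟩ := (h.g_bijective z₂).2 x₀
    have := h₁ x y₀ z₁
    have := h₂ x y₀ z₁
    have := h₃ x y₀ z₁
    have : g x y₀ = x₂ := @hg z₁ _ _ (by grind)
    exact ⟨x, by grind⟩
  · obtain ⟨z, hz⟩ := (h.f_bijective x₂).2 z₀
    have := h₁ x₁ y₀ z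
    have := h₂ x₁ y₀ z
    have := h₃ x₁ y₀ z
    have : f y₀ z = z₂ := @hf x₁ _ _ (by grind)
    exact ⟨z, by grind⟩
  · obtain ⟨y, x, hy, hx⟩ := h.pair_surjective z₀ y₀
    have := h₁ x₀ y x
    have := h₂ x₀ y x
    have := h₃ x₀ y x
    exact ⟨y, by grind⟩
  · have := h₁ x₀ y₁ z₁
    have := h₂ x₀ y₁ z₁
    have := h₃ x₀ y₁ z₁
    grind
  all_goals
    have := h₁ x₀ y₀ z₀
    have := h₂ x₀ y₀ z₀
    have := h₃ x₀ y₀ z₀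
    grind

theorem triangle_unique_of_positive (h : IsBiquandle f g) {t r d : Bool}
    {x₀ x₁ x₂ y₀ y₁ y₂ z₀ z₁ z₂ x y z : N}
    (ht : Triangle f g .over .over .over true t r d x₀ x₁ x₂ y₀ y₁ y₂ z₀ z₁ z₂)
    (ht' : Triangle f g .over .over .over true t r d x₀ x x₂ y₀ y y₂ z₀ z z₂) :
    x₁ = x ∧ y₁ = y ∧ z₁ = z := by
  have hf := fun o => (h.f_bijective o).1
  have hg := fun u => (h.g_bijective u).1
  have hp := h.pair_injective
  unfold Triangle at ht ht'
  cases t <;> cases r <;> cases d <;>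
    simp [Crossing, seg, Function.Injective] at ht ht' hf hg <;> grind

theorem slides_over (h : IsBiquandle f g) : Slides f g .over .over .over where
  exists_slide {s t r d _ _ _ _ _ _ _ _ _} ht := by
    cases s
    · obtain ⟨x, y, z, h'⟩ := exists_slide_of_positive h (triangle_reverse.2 ht)
      exact ⟨x, y, z, triangle_reverse.1 h'⟩
    · exact exists_slide_of_positive h ht
  unique {s t r d _ _ _ _ _ _ _ _ _ _ _ _} ht ht' := by
    cases s
    · exact triangle_unique_of_positive h (triangle_reverse.2 ht) (triangle_reverse.2 ht')
    · exact triangle_unique_of_positive h ht ht'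

/-- The two transpositions of strands generate all permutations, so the order `1 > 2 > 3` yields all
six height orders, and the case of a virtual first strand yields that of any virtual strand. -/
theorem slides_of_allowedTriple (h : IsBiquandle f g) {a b c : Level}
    (ha : AllowedTriple a b c) : Slides f g a b c := by
  have h₁ := slides_over h
  have h₂ := h₁.swap_first
  have h₃ := h₁.swap_last
  have h₄ := h₂.swap_last
  have h₅ := h₃.swap_first
  have h₆ := h₄.swap_first
  have v₁ := fun c => slides_virtual (f := f) (g := g) c
  have v₂ := fun c => (v₁ c).swap_first
  have v₃ := fun c => (v₂ c).swap_last
  cases a <;> cases b <;> cases c <;> simp [AllowedTriple] at ha <;>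
    first | assumption | exact v₁ _ | exact v₂ _ | exact v₃ _

end Local

/-! ### Colourings of words -/

theorem Passage.partner_partner (p : Passage) : p.partner.partner = p := by
  cases p; simp [Passage.partner, Level.swap_swap]

theorem Passage.rename_partner (h : ℕ → ℕ) (p : Passage) :
    (p.rename h).partner = p.partner.rename h := rfl

theorem Passage.rename_injective {h : ℕ → ℕ} (hh : Function.Injective h) :
    Function.Injective (Passage.rename h) := by
  rintro ⟨k, l, b⟩ ⟨k', l', b'⟩ hp
  simp only [Passage.rename, Passage.mk.injEq] at hp ⊢
  exact ⟨hh hp.1, hp.2⟩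

section Words

variable {N : Type*}

/-- Following the word `w` from colour `a` to colour `b`, where `φ` assigns to every passage the
incoming and the outgoing colour. -/
def IsPath (φ : Passage → N × N) : List Passage → N → N → Prop
  | [], a, b => a = b
  | p :: w, a, b => (φ p).1 = a ∧ IsPath φ w (φ p).2 b

variable {φ ψ : Passage → N × N}

theorem isPath_append {u v : List Passage} {a b : N} :
    IsPath φ (u ++ v) a b ↔ ∃ c, IsPath φ u a c ∧ IsPath φ v c b := by
  induction u generalizing a with
  | nil => simp [IsPath]
  | cons p u ih => simp [IsPath, ih, and_assoc]

theorem IsPath.congr {w : List Passage} {a b : N} (h : ∀ p ∈ w, ψ p = φ p)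
    (hp : IsPath φ w a b) : IsPath ψ w a b := by
  induction w generalizing a with
  | nil => exact hp
  | cons p w ih =>
    simp only [List.mem_cons, forall_eq_or_imp] at h
    simp only [IsPath, h.1] at hp ⊢
    exact ⟨hp.1, ih h.2 hp.2⟩

theorem IsPath.end_unique {w : List Passage} {a b c : N} (hb : IsPath φ w a b)
    (hc : IsPath φ w a c) : b = c := by
  induction w generalizing a with
  | nil => exact hb.symm.trans hc
  | cons p w ih => exact ih hb.2 hc.2

theorem IsPath.start_unique {w : List Passage} {a b c : N} (ha : IsPath φ w a c)
    (hb : IsPath φ w b c) : a = b := by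
  cases w with
  | nil => exact ha.trans hb.symm
  | cons p w => exact ha.1.symm.trans hb.1

theorem isPath_map {σ : Passage → Passage} {w : List Passage} {a b : N} :
    IsPath φ (w.map σ) a b ↔ IsPath (φ ∘ σ) w a b := by
  induction w generalizing a with
  | nil => rfl
  | cons p w ih => simp [IsPath, ih]

theorem isPath_pair {p q : Passage} {a b : N} :
    IsPath φ [p, q] a b ↔ ∃ m, φ p = (a, m) ∧ φ q = (m, b) := by
  simp only [IsPath, Prod.ext_iff]
  grind

theorem isPath_ordered {p q : Passage} {a b : N} {e : Bool} :
    IsPath φ (ordered e p q) a b ↔ ∃ m, φ p = seg e a m b ∧ φ q = seg (!e) a m b := by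
  cases e
  · simp [ordered, seg, isPath_pair, and_comm]
  · simp [ordered, seg, isPath_pair]

theorem isPath_iff_exists_edges {w : List Passage} {a b : N} :
    IsPath φ w a b ↔ ∃ e : ℕ → N, e 0 = a ∧ e w.length = b ∧
      ∀ (i : ℕ) (hi : i < w.length), φ w[i] = (e i, e (i + 1)) := by
  induction w generalizing a with
  | nil => exact ⟨fun h => ⟨fun _ => a, rfl, h, by simp⟩, by rintro ⟨e, rfl, rfl, -⟩; rfl⟩
  | cons p w ih =>
    simp only [IsPath, ih]
    constructor
    · rintro ⟨h₁, e, h₂, h₃, h₄⟩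
      refine ⟨fun i => i.casesOn a e, rfl, h₃, fun i hi => ?_⟩
      cases i with
      | zero => exact Prod.ext h₁ h₂.symm
      | succ i => exact h₄ i (by simpa using hi)
    · rintro ⟨e, h₂, h₃, h₄⟩
      have h₀ := h₄ 0 (by simp)
      simp only [List.getElem_cons_zero, zero_add] at h₀
      refine ⟨by rw [h₀, h₂], fun i => e (i + 1), by rw [h₀], h₃, fun i hi => ?_⟩
      exact h₄ (i + 1) (by simpa using hi)

/-- A colouring of the word `w` with first colour `a` and last colour `b`. -/
structure IsColoring (f g : N → N → N) (w : List Passage) (φ : Passage → N × N) (a b : N) :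
    Prop where
  isPath : IsPath φ w a b
  crossing : ∀ p ∈ w, Crossing f g p.level p.side (φ p) (φ p.partner)

/-- Used to colour the passages of a move while keeping all others. -/
theorem exists_override (φ : Passage → N × N) (l : List (Passage × (N × N)))
    (hl : (l.map Prod.fst).Nodup) :
    ∃ ψ : Passage → N × N, (∀ e ∈ l, ψ e.1 = e.2) ∧ ∀ q, q ∉ l.map Prod.fst → ψ q = φ q := by
  classical
  induction l with
  | nil => exact ⟨φ, by simp, by simp⟩
  | cons e l ih =>
    simp only [List.map_cons, List.nodup_cons] at hl
    obtain ⟨ψ, h₁, h₂⟩ := ih hl.2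
    refine ⟨Function.update ψ e.1 e.2, ?_, ?_⟩
    · simp only [List.mem_cons, forall_eq_or_imp, Function.update_self, true_and]
      intro e' he'
      rw [Function.update_of_ne, h₁ e' he']
      rintro h
      exact hl.1 (h ▸ List.mem_map_of_mem he')
    · intro q hq
      simp only [List.map_cons, List.mem_cons, not_or] at hq
      rw [Function.update_of_ne hq.1, h₂ q hq.2]

end Words

/-! ### Transport of colourings along moves -/

/-- Colourings of `w` and of `w'` correspond to each other: `σ` sends the passages of `w` that
satisfy `P` to passages of `w'`, and `K` pairs passages of `w` with passages of `w'`. A colouring of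
one word determines a unique colouring of the other one with the same end colours, the same
colours at the passages in `P` and the same outgoing colours at the passages paired by `K`. -/
structure Transfer.{u} (w w' : List Passage) (P : Passage → Prop) (σ : Passage → Passage)
    (K : Passage → Passage → Prop) : Prop where
  mem : ∀ p, P p → p ∈ w ∧ σ p ∈ w'
  mem_pair : ∀ p q, K p q → p ∈ w ∧ q ∈ w'
  forth : ∀ {N : Type u} {f g : N → N → N}, IsBiquandle f g → ∀ {φ a b},
    IsColoring f g w φ a b → ∃ ψ, IsColoring f g w' ψ a b ∧ (∀ p, P p → ψ (σ p) = φ p) ∧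
      ∀ p q, K p q → (ψ q).2 = (φ p).2
  back : ∀ {N : Type u} {f g : N → N → N}, IsBiquandle f g → ∀ {ψ a b},
    IsColoring f g w' ψ a b → ∃ φ, IsColoring f g w φ a b ∧ (∀ p, P p → ψ (σ p) = φ p) ∧
      ∀ p q, K p q → (ψ q).2 = (φ p).2
  unique_left : ∀ {N : Type u} {f g : N → N → N}, IsBiquandle f g → ∀ {φ φ' a b},
    IsColoring f g w φ a b → IsColoring f g w φ' a b → (∀ p, P p → φ p = φ' p) →
      (∀ p q, K p q → (φ p).2 = (φ' p).2) → ∀ p ∈ w, φ p = φ' p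
  unique_right : ∀ {N : Type u} {f g : N → N → N}, IsBiquandle f g → ∀ {ψ ψ' a b},
    IsColoring f g w' ψ a b → IsColoring f g w' ψ' a b → (∀ p, P p → ψ (σ p) = ψ' (σ p)) →
      (∀ p q, K p q → (ψ q).2 = (ψ' q).2) → ∀ p ∈ w', ψ p = ψ' p

theorem transfer_rename {h : ℕ → ℕ} (hh : Function.Injective h) (w : List Passage) :
    Transfer w (w.map (Passage.rename h)) (· ∈ w) (Passage.rename h)
      (fun _ _ => False) where
  mem p hp := ⟨hp, List.mem_map_of_mem hp⟩
  mem_pair _ _ h := h.elim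
  forth {N f g} _ φ a b hφ := by
    have hinj := Passage.rename_injective hh
    have hφ' : Function.extend (Passage.rename h) φ φ ∘ Passage.rename h = φ :=
      funext fun p => hinj.extend_apply ..
    refine ⟨Function.extend (Passage.rename h) φ φ, ⟨?_, ?_⟩, fun p _ => hinj.extend_apply ..,
      fun _ _ h => h.elim⟩
    · rw [isPath_map, hφ']
      exact hφ.isPath
    · intro p hp
      obtain ⟨q, hq, rfl⟩ := List.mem_map.1 hp
      rw [Passage.rename_partner, hinj.extend_apply, hinj.extend_apply]
      exact hφ.crossing q hq
  back {N f g} _ ψ a b hψ :=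
    ⟨ψ ∘ Passage.rename h, ⟨isPath_map.1 hψ.isPath,
      fun p hp => hψ.crossing _ (List.mem_map_of_mem hp)⟩, fun _ _ => rfl, fun _ _ h => h.elim⟩
  unique_left _ _ _ _ _ _ _ h _ := h
  unique_right _ _ _ _ _ _ _ h _ := by
    intro p hp
    obtain ⟨q, hq, rfl⟩ := List.mem_map.1 hp
    exact h q hq

theorem transfer_kink {u v : List Passage} {p : Passage} (hw : IsCode (u ++ v))
    (hw' : IsCode (u ++ [p, p.partner] ++ v)) :
    Transfer (u ++ v) (u ++ [p, p.partner] ++ v) (· ∈ u ++ v) id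
      (fun _ _ => False) where
  mem q hq := ⟨hq, by simp at hq ⊢; tauto⟩
  mem_pair _ _ h := h.elim
  forth {N f g} hfg φ a b hφ := by
    have hnd := hw'.nodup
    obtain ⟨x, h₁, h₂⟩ := isPath_append.1 hφ.isPath
    obtain ⟨y, hy⟩ := exists_kink hfg p.level p.side x
    obtain ⟨ψ, hψ, hψ'⟩ := exists_override φ [(p, (x, y)), (p.partner, (y, x))]
      (by simp [List.nodup_append] at hnd ⊢; tauto)
    simp only [List.mem_cons, List.not_mem_nil, or_false, forall_eq_or_imp, forall_eq] at hψ
    have hagree : ∀ q ∈ u ++ v, ψ q = φ q := by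
      intro q hq
      refine hψ' q ?_
      simp [List.nodup_append] at hnd hq ⊢
      grind
    refine ⟨ψ, ⟨?_, ?_⟩, hagree, fun _ _ h => h.elim⟩
    · refine isPath_append.2 ⟨x, isPath_append.2 ⟨x, ?_, isPath_pair.2 ⟨y, hψ⟩⟩, ?_⟩
      · exact h₁.congr fun q hq => hagree q (by simp [hq])
      · exact h₂.congr fun q hq => hagree q (by simp [hq])
    · intro q hq
      have : q = p ∨ q = p.partner ∨ q ∈ u ++ v := by simp at hq ⊢; tauto
      rcases this with rfl | rfl | hq
      · rwa [hψ.1, hψ.2]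
      · rw [Passage.partner_partner, hψ.1, hψ.2]
        exact (crossing_swap ..).2 hy
      -- The old word is itself a code, so both passages of an old crossing keep their colours.
      · rw [hagree q hq, hagree _ (hw.partner_mem q hq)]
        exact hφ.crossing q hq
  back {N f g} hfg ψ a b hψ := by
    refine ⟨ψ, ⟨?_, fun q hq => hψ.crossing q (by simp at hq ⊢; tauto)⟩, fun _ _ => rfl,
      fun _ _ h => h.elim⟩
    obtain ⟨z, h, h₃⟩ := isPath_append.1 hψ.isPath
    obtain ⟨x, h₁, h₂⟩ := isPath_append.1 h
    obtain ⟨y, hy, hy'⟩ := isPath_pair.1 h₂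
    have hc := hψ.crossing p (by simp)
    rw [hy, hy'] at hc
    obtain rfl := hc.kink_eq hfg
    exact isPath_append.2 ⟨z, h₁, h₃⟩
  unique_left _ _ _ _ _ _ _ h _ := h
  unique_right {N f g} hfg ψ ψ' a b hψ hψ' heq _ := by
    simp only [id] at heq
    obtain ⟨z, h, h₃⟩ := isPath_append.1 hψ.isPath
    obtain ⟨x, h₁, h₂⟩ := isPath_append.1 h
    obtain ⟨y, hy, hy'⟩ := isPath_pair.1 h₂
    obtain ⟨z', h', h₃'⟩ := isPath_append.1 hψ'.isPath
    obtain ⟨x', h₁', h₂'⟩ := isPath_append.1 h'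
    obtain ⟨y', hz, hz'⟩ := isPath_pair.1 h₂'
    have hc := hψ.crossing p (by simp)
    have hc' := hψ'.crossing p (by simp)
    rw [hy, hy'] at hc
    rw [hz, hz'] at hc'
    obtain rfl := hc.kink_eq hfg
    obtain rfl := hc'.kink_eq hfg
    -- Both paths through `u` start at `a`, so the colour entering the kink is determined even when
    -- `u` is empty.
    obtain rfl := h₁.end_unique (h₁'.congr fun q hq => heq q (by simp [hq]))
    obtain rfl := hc.kink_unique hfg hc'
    intro q hq
    have : q = p ∨ q = p.partner ∨ q ∈ u ++ v := by simp at hq ⊢; tauto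
    rcases this with rfl | rfl | hq
    · rw [hy, hz]
    · rw [hy', hz']
    · exact heq q hq

theorem transfer_bigon {u v w : List Passage} {p q : Passage} {e : Bool}
    (hlevel : q.level = p.level) (hside : q.side = !p.side) (hw : IsCode (u ++ v ++ w))
    (hw' : IsCode (u ++ [p, q] ++ v ++ ordered e p.partner q.partner ++ w)) :
    Transfer (u ++ v ++ w) (u ++ [p, q] ++ v ++ ordered e p.partner q.partner ++ w)
      (· ∈ u ++ v ++ w) id (fun _ _ => False) := by
  have hmem : ∀ r, r ∈ u ++ [p, q] ++ v ++ ordered e p.partner q.partner ++ w ↔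
      r = p ∨ r = q ∨ r = p.partner ∨ r = q.partner ∨ r ∈ u ++ v ++ w := by
    intro r
    cases e <;> simp [ordered] <;> tauto
  have hbigon : ∀ {N : Type _} {f g : N → N → N} {x₀ x₁ x₂ y₀ y₁ y₂ : N} {ψ : Passage → N × N},
      ψ p = (x₀, x₁) → ψ q = (x₁, x₂) → ψ p.partner = seg e y₀ y₁ y₂ →
      ψ q.partner = seg (!e) y₀ y₁ y₂ →
      ((Crossing f g p.level p.side (ψ p) (ψ p.partner) ∧
        Crossing f g q.level q.side (ψ q) (ψ q.partner)) ↔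
      Bigon f g p.level p.side e x₀ x₁ x₂ y₀ y₁ y₂) := by
    intro N f g x₀ x₁ x₂ y₀ y₁ y₂ ψ h₁ h₂ h₃ h₄
    rw [h₁, h₂, h₃, h₄, hlevel, hside]
    rfl
  have hnd := hw'.nodup
  refine ⟨fun r hr => ⟨hr, (hmem r).2 (by tauto)⟩, fun _ _ h => h.elim, ?_, ?_,
    fun _ _ _ _ _ _ _ h _ => h, ?_⟩
  · intro N f g hfg φ a b hφ
    obtain ⟨y, h, h₃⟩ := isPath_append.1 hφ.isPath
    obtain ⟨x, h₁, h₂⟩ := isPath_append.1 h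
    obtain ⟨x₁, y₁, hb⟩ := exists_bigon hfg p.level p.side e x y
    obtain ⟨ψ, hψ, hψ'⟩ := exists_override φ [(p, (x, x₁)), (q, (x₁, x)),
      (p.partner, seg e y y₁ y), (q.partner, seg (!e) y y₁ y)]
      (by cases e <;> simp [List.nodup_append, ordered] at hnd ⊢ <;> grind)
    simp only [List.mem_cons, List.not_mem_nil, or_false, forall_eq_or_imp, forall_eq] at hψ
    obtain ⟨hp, hq, hp', hq'⟩ := hψ
    have hagree : ∀ r ∈ u ++ v ++ w, ψ r = φ r := by
      intro r hr
      refine hψ' r ?_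
      cases e <;> simp [List.nodup_append, ordered] at hnd hr ⊢ <;> grind
    obtain ⟨hcp, hcq⟩ := (hbigon hp hq hp' hq').2 hb
    refine ⟨ψ, ⟨?_, ?_⟩, hagree, fun _ _ h => h.elim⟩
    · refine isPath_append.2 ⟨y, isPath_append.2 ⟨y, isPath_append.2 ⟨x, isPath_append.2 ⟨x, ?_,
        isPath_pair.2 ⟨x₁, hp, hq⟩⟩, ?_⟩, isPath_ordered.2 ⟨y₁, hp', hq'⟩⟩, ?_⟩
      · exact h₁.congr fun q hq => hagree q (by simp [hq])
      · exact h₂.congr fun q hq => hagree q (by simp [hq])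
      · exact h₃.congr fun q hq => hagree q (by simp [hq])
    · intro r hr
      rcases (hmem r).1 hr with rfl | rfl | rfl | rfl | hr
      · exact hcp
      · exact hcq
      · rw [Passage.partner_partner]
        exact (crossing_swap ..).2 hcp
      · rw [Passage.partner_partner]
        exact (crossing_swap ..).2 hcq
      · rw [hagree r hr, hagree _ (hw.partner_mem r hr)]
        exact hφ.crossing r hr
  · intro N f g hfg ψ a b hψ
    refine ⟨ψ, ⟨?_, fun r hr => hψ.crossing r ((hmem r).2 (by tauto))⟩, fun _ _ => rfl,
      fun _ _ h => h.elim⟩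
    obtain ⟨y₂, h, h₃⟩ := isPath_append.1 hψ.isPath
    obtain ⟨y, h, hy⟩ := isPath_append.1 h
    obtain ⟨x₂, h, h₂⟩ := isPath_append.1 h
    obtain ⟨x, h₁, hx⟩ := isPath_append.1 h
    obtain ⟨x₁, hp, hq⟩ := isPath_pair.1 hx
    obtain ⟨y₁, hp', hq'⟩ := isPath_ordered.1 hy
    have hb := (hbigon hp hq hp' hq').1
      ⟨hψ.crossing p ((hmem p).2 (by tauto)), hψ.crossing q ((hmem q).2 (by tauto))⟩
    -- Each strand leaves the bigon with the colour it entered with, so the remaining pieces of the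
    -- path fit together.
    obtain ⟨rfl, rfl⟩ := hb.eq hfg
    exact isPath_append.2 ⟨_, isPath_append.2 ⟨_, h₁, h₂⟩, h₃⟩
  · intro N f g hfg ψ ψ' a b hψ hψ' heq _
    simp only [id] at heq
    obtain ⟨y₂, h, h₃⟩ := isPath_append.1 hψ.isPath
    obtain ⟨y, h, hy⟩ := isPath_append.1 h
    obtain ⟨x₂, h, h₂⟩ := isPath_append.1 h
    obtain ⟨x, h₁, hx⟩ := isPath_append.1 h
    obtain ⟨x₁, hp, hq⟩ := isPath_pair.1 hx
    obtain ⟨y₁, hp', hq'⟩ := isPath_ordered.1 hy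
    have hb := (hbigon hp hq hp' hq').1
      ⟨hψ.crossing p ((hmem p).2 (by tauto)), hψ.crossing q ((hmem q).2 (by tauto))⟩
    obtain ⟨rfl, rfl⟩ := hb.eq hfg
    obtain ⟨y₂', h, h₃'⟩ := isPath_append.1 hψ'.isPath
    obtain ⟨y', h, hy⟩ := isPath_append.1 h
    obtain ⟨x₂', h, h₂'⟩ := isPath_append.1 h
    obtain ⟨x', h₁', hx⟩ := isPath_append.1 h
    obtain ⟨x₁', hr, hs⟩ := isPath_pair.1 hx
    obtain ⟨y₁', hr', hs'⟩ := isPath_ordered.1 hy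
    have hb' := (hbigon hr hs hr' hs').1
      ⟨hψ'.crossing p ((hmem p).2 (by tauto)), hψ'.crossing q ((hmem q).2 (by tauto))⟩
    obtain ⟨rfl, rfl⟩ := hb'.eq hfg
    obtain rfl := h₁.end_unique (h₁'.congr fun q hq => heq q (by simp [hq]))
    obtain rfl := h₂.end_unique (h₂'.congr fun q hq => heq q (by simp [hq]))
    obtain ⟨rfl, rfl⟩ := hb.unique hfg hb'
    intro t ht
    rcases (hmem t).1 ht with rfl | rfl | rfl | rfl | ht
    · rw [hp, hr]
    · rw [hq, hs]
    · rw [hp', hr']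
    · rw [hq', hs']
    · exact heq t ht

/-! ### Transport of colourings along the third move -/

/-- The words in the third move. -/
def triangleWord (u v w z : List Passage) (a b c : Passage) (d : Bool) : List Passage :=
  u ++ ordered (d ^^ a.side ^^ b.side) a b ++ v ++
    ordered (d ^^ a.side ^^ c.side) a.partner c ++ w ++
    ordered (d ^^ b.side ^^ c.side) b.partner c.partner ++ z

/-- The second passage in `ordered e p q`. -/
def second (e : Bool) (p q : Passage) : Passage := if e then q else p

theorem snd_second {N : Type*} {φ : Passage → N × N} {e : Bool} {p q : Passage} {x y t : N}
    (hp : φ p = seg e x y t) (hq : φ q = seg (!e) x y t) : (φ (second e p q)).2 = t := by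
  cases e
  · simp [second, hp, seg]
  · simp [second, hq, seg]

/-- The passages at which the first two strands leave the triangle, before and after the third
move. -/
def LeavePair (a b c : Passage) (d : Bool) (p q : Passage) : Prop :=
  (p = second (d ^^ a.side ^^ b.side) a b ∧ q = second (!d ^^ a.side ^^ b.side) a b) ∨
  (p = second (d ^^ a.side ^^ c.side) a.partner c ∧
    q = second (!d ^^ a.side ^^ c.side) a.partner c)

section Triangle

variable {u v w z : List Passage} {a b c : Passage} {d : Bool}

theorem mem_ordered {e : Bool} {p q r : Passage} : r ∈ ordered e p q ↔ r = p ∨ r = q := by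
  cases e <;> simp [ordered, or_comm]

theorem mem_triangleWord {r : Passage} :
    r ∈ triangleWord u v w z a b c d ↔ (r = a ∨ r = b ∨ r = c ∨ r = a.partner ∨ r = b.partner ∨
      r = c.partner) ∨ r ∈ u ++ v ++ w ++ z := by
  simp only [triangleWord, List.mem_append, mem_ordered]
  tauto

theorem ordered_perm (e : Bool) (p q : Passage) : (ordered e p q).Perm [p, q] := by
  cases e
  · exact List.Perm.swap ..
  · exact List.Perm.refl _

theorem triangleWord_perm : (triangleWord u v w z a b c d).Perm
    ([a, b, c, a.partner, b.partner, c.partner] ++ (u ++ v ++ w ++ z)) := by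
  classical
  rw [List.perm_iff_count]
  intro r
  simp only [triangleWord, List.count_append, (ordered_perm _ _ _).count_eq, List.count_cons,
    List.count_nil]
  ring

variable {N : Type*} {f g : N → N → N} {φ φ' : Passage → N × N} {k l : N}

/-- The colours on the three strands of a triangle in a coloured word. -/
structure TriangleColors (f g : N → N → N) (u v w z : List Passage) (a b c : Passage) (d : Bool)
    (φ : Passage → N × N) (k l x₀ x₁ x₂ y₀ y₁ y₂ z₀ z₁ z₂ : N) : Prop where
  path₁ : IsPath φ u k x₀
  path₂ : IsPath φ v x₂ y₀
  path₃ : IsPath φ w y₂ z₀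
  path₄ : IsPath φ z z₂ l
  a_eq : φ a = seg (d ^^ a.side ^^ b.side) x₀ x₁ x₂
  b_eq : φ b = seg (!(d ^^ a.side ^^ b.side)) x₀ x₁ x₂
  a_partner_eq : φ a.partner = seg (d ^^ a.side ^^ c.side) y₀ y₁ y₂
  c_eq : φ c = seg (!(d ^^ a.side ^^ c.side)) y₀ y₁ y₂
  b_partner_eq : φ b.partner = seg (d ^^ b.side ^^ c.side) z₀ z₁ z₂
  c_partner_eq : φ c.partner = seg (!(d ^^ b.side ^^ c.side)) z₀ z₁ z₂
  triangle : Triangle f g a.level b.level c.level a.side b.side c.side d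
    x₀ x₁ x₂ y₀ y₁ y₂ z₀ z₁ z₂

theorem IsColoring.exists_triangleColors
    (h : IsColoring f g (triangleWord u v w z a b c d) φ k l) :
    ∃ x₀ x₁ x₂ y₀ y₁ y₂ z₀ z₁ z₂,
      TriangleColors f g u v w z a b c d φ k l x₀ x₁ x₂ y₀ y₁ y₂ z₀ z₁ z₂ := by
  have ha := h.crossing a (mem_triangleWord.2 (by tauto))
  have hb := h.crossing b (mem_triangleWord.2 (by tauto))
  have hc := h.crossing c (mem_triangleWord.2 (by tauto))
  obtain ⟨z₂, h, h₄⟩ := isPath_append.1 h.isPath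
  obtain ⟨z₀, h, hz⟩ := isPath_append.1 h
  obtain ⟨y₂, h, h₃⟩ := isPath_append.1 h
  obtain ⟨y₀, h, hy⟩ := isPath_append.1 h
  obtain ⟨x₂, h, h₂⟩ := isPath_append.1 h
  obtain ⟨x₀, h₁, hx⟩ := isPath_append.1 h
  obtain ⟨x₁, ea, eb⟩ := isPath_ordered.1 hx
  obtain ⟨y₁, ea', ec⟩ := isPath_ordered.1 hy
  obtain ⟨z₁, eb', ec'⟩ := isPath_ordered.1 hz
  refine ⟨x₀, x₁, x₂, y₀, y₁, y₂, z₀, z₁, z₂, h₁, h₂, h₃, h₄, ea, eb, ea', ec, eb', ec', ?_⟩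
  rw [ea, ea'] at ha
  rw [eb, eb'] at hb
  rw [ec, ec'] at hc
  exact ⟨ha, hb, hc⟩

theorem TriangleColors.isColoring {x₀ x₁ x₂ y₀ y₁ y₂ z₀ z₁ z₂ : N}
    (h : TriangleColors f g u v w z a b c d φ k l x₀ x₁ x₂ y₀ y₁ y₂ z₀ z₁ z₂)
    (hc : ∀ p ∈ u ++ v ++ w ++ z, Crossing f g p.level p.side (φ p) (φ p.partner)) :
    IsColoring f g (triangleWord u v w z a b c d) φ k l where
  isPath := isPath_append.2 ⟨_, isPath_append.2 ⟨_, isPath_append.2 ⟨_, isPath_append.2 ⟨_,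
    isPath_append.2 ⟨_, isPath_append.2 ⟨_, h.path₁, isPath_ordered.2 ⟨_, h.a_eq, h.b_eq⟩⟩,
    h.path₂⟩, isPath_ordered.2 ⟨_, h.a_partner_eq, h.c_eq⟩⟩, h.path₃⟩,
    isPath_ordered.2 ⟨_, h.b_partner_eq, h.c_partner_eq⟩⟩, h.path₄⟩
  crossing p hp := by
    obtain ⟨h₁, h₂, h₃⟩ := h.triangle
    rw [← h.a_eq, ← h.a_partner_eq] at h₁
    rw [← h.b_eq, ← h.b_partner_eq] at h₂
    rw [← h.c_eq, ← h.c_partner_eq] at h₃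
    rcases mem_triangleWord.1 hp with (rfl | rfl | rfl | rfl | rfl | rfl) | hp
    · exact h₁
    · exact h₂
    · exact h₃
    · rw [Passage.partner_partner]
      exact (crossing_swap ..).2 h₁
    · rw [Passage.partner_partner]
      exact (crossing_swap ..).2 h₂
    · rw [Passage.partner_partner]
      exact (crossing_swap ..).2 h₃
    · exact hc p hp

/-- The six passages of the triangle are closed under `partner`, and the absence of repetitions
keeps them apart from the rest. -/
theorem IsCode.partner_mem_rest (hw : IsCode (triangleWord u v w z a b c d)) {p : Passage}
    (hp : p ∈ u ++ v ++ w ++ z) : p.partner ∈ u ++ v ++ w ++ z := by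
  have hnd := (triangleWord_perm.nodup_iff).1 hw.nodup
  rw [List.nodup_append] at hnd
  have hd := hnd.2.2
  rcases mem_triangleWord.1 (hw.partner_mem p (mem_triangleWord.2 (Or.inr hp))) with h | h
  · have := Passage.partner_partner p
    exfalso
    rcases h with h | h | h | h | h | h <;> rw [h] at this <;>
      (try simp only [Passage.partner_partner] at this) <;> exact hd _ (by simp) _ hp this
  · exact h

theorem exists_triangle_slide (hfg : IsBiquandle f g)
    (ht : AllowedTriple a.level b.level c.level)
    (hw : IsCode (triangleWord u v w z a b c d))
    (hφ : IsColoring f g (triangleWord u v w z a b c d) φ k l) :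
    ∃ ψ, IsColoring f g (triangleWord u v w z a b c (!d)) ψ k l ∧
      (∀ p ∈ u ++ v ++ w ++ z, ψ p = φ p) ∧
      ∀ p q, LeavePair a b c d p q → (ψ q).2 = (φ p).2 := by
  obtain ⟨x₀, x₁, x₂, y₀, y₁, y₂, z₀, z₁, z₂, h⟩ := hφ.exists_triangleColors
  obtain ⟨x, y, t, hs⟩ := (slides_of_allowedTriple hfg ht).exists_slide h.triangle
  have hnd := (triangleWord_perm.nodup_iff).1 hw.nodup
  rw [List.nodup_append] at hnd
  obtain ⟨ψ, hψ, hψ'⟩ := exists_override φ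
    [(a, seg (!d ^^ a.side ^^ b.side) x₀ x x₂), (b, seg (!(!d ^^ a.side ^^ b.side)) x₀ x x₂),
      (c, seg (!(!d ^^ a.side ^^ c.side)) y₀ y y₂),
      (a.partner, seg (!d ^^ a.side ^^ c.side) y₀ y y₂),
      (b.partner, seg (!d ^^ b.side ^^ c.side) z₀ t z₂),
      (c.partner, seg (!(!d ^^ b.side ^^ c.side)) z₀ t z₂)] hnd.1
  have hagree : ∀ p ∈ u ++ v ++ w ++ z, ψ p = φ p :=
    fun p hp => hψ' p fun hp' => hnd.2.2 p hp' p hp rfl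
  simp only [List.mem_cons, List.not_mem_nil, or_false, forall_eq_or_imp, forall_eq] at hψ
  obtain ⟨ea, eb, ec, ea', eb', ec'⟩ := hψ
  refine ⟨ψ, TriangleColors.isColoring (x₀ := x₀) (x₁ := x) (x₂ := x₂) (y₀ := y₀) (y₁ := y)
    (y₂ := y₂) (z₀ := z₀) (z₁ := t) (z₂ := z₂) ⟨?_, ?_, ?_, ?_, ea, eb, ea', ec, eb', ec', hs⟩ ?_,
    hagree, ?_⟩
  · exact h.path₁.congr fun q hq => hagree q (by simp [hq])
  · exact h.path₂.congr fun q hq => hagree q (by simp [hq])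
  · exact h.path₃.congr fun q hq => hagree q (by simp [hq])
  · exact h.path₄.congr fun q hq => hagree q (by simp [hq])
  · intro p hp
    rw [hagree p hp, hagree _ (hw.partner_mem_rest hp)]
    exact hφ.crossing p (mem_triangleWord.2 (Or.inr hp))
  · rintro p q (⟨rfl, rfl⟩ | ⟨rfl, rfl⟩)
    · rw [snd_second ea eb, snd_second h.a_eq h.b_eq]
    · rw [snd_second ea' ec, snd_second h.a_partner_eq h.c_eq]

/-- Where `v` or `w` is empty, no passage outside the triangle records the colour between two of its
strands. Hence the hypotheses on the leaving colours of the first two strands; the other boundary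
colours follow along `u`, `v`, `w` and, backwards from the end, `z`. -/
theorem triangle_coloring_unique (hfg : IsBiquandle f g)
    (ht : AllowedTriple a.level b.level c.level)
    (hφ : IsColoring f g (triangleWord u v w z a b c d) φ k l)
    (hφ' : IsColoring f g (triangleWord u v w z a b c d) φ' k l)
    (heq : ∀ p ∈ u ++ v ++ w ++ z, φ p = φ' p)
    (hx : (φ (second (d ^^ a.side ^^ b.side) a b)).2 =
      (φ' (second (d ^^ a.side ^^ b.side) a b)).2)
    (hy : (φ (second (d ^^ a.side ^^ c.side) a.partner c)).2 =
      (φ' (second (d ^^ a.side ^^ c.side) a.partner c)).2) :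
    ∀ p ∈ triangleWord u v w z a b c d, φ p = φ' p := by
  obtain ⟨x₀, x₁, x₂, y₀, y₁, y₂, z₀, z₁, z₂, h⟩ := hφ.exists_triangleColors
  obtain ⟨x₀', x₁', x₂', y₀', y₁', y₂', z₀', z₁', z₂', h'⟩ := hφ'.exists_triangleColors
  obtain rfl : x₂ = x₂' := by
    rwa [snd_second h.a_eq h.b_eq, snd_second h'.a_eq h'.b_eq] at hx
  obtain rfl : y₂ = y₂' := by
    rwa [snd_second h.a_partner_eq h.c_eq, snd_second h'.a_partner_eq h'.c_eq] at hy
  obtain rfl := h.path₁.end_unique (h'.path₁.congr fun q hq => heq q (by simp [hq]))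
  obtain rfl := h.path₂.end_unique (h'.path₂.congr fun q hq => heq q (by simp [hq]))
  obtain rfl := h.path₃.end_unique (h'.path₃.congr fun q hq => heq q (by simp [hq]))
  obtain rfl := h.path₄.start_unique (h'.path₄.congr fun q hq => heq q (by simp [hq]))
  obtain ⟨rfl, rfl, rfl⟩ := (slides_of_allowedTriple hfg ht).unique h.triangle h'.triangle
  intro p hp
  rcases mem_triangleWord.1 hp with (rfl | rfl | rfl | rfl | rfl | rfl) | hp
  · rw [h.a_eq, h'.a_eq]
  · rw [h.b_eq, h'.b_eq]
  · rw [h.c_eq, h'.c_eq]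
  · rw [h.a_partner_eq, h'.a_partner_eq]
  · rw [h.b_partner_eq, h'.b_partner_eq]
  · rw [h.c_partner_eq, h'.c_partner_eq]
  · exact heq p hp

theorem leavePair_flip {p q : Passage} (h : LeavePair a b c d p q) :
    LeavePair a b c (!d) q p := by
  rcases h with ⟨rfl, rfl⟩ | ⟨rfl, rfl⟩ <;> simp [LeavePair]

theorem LeavePair.left_mem {p q : Passage} (h : LeavePair a b c d p q) :
    p ∈ triangleWord u v w z a b c d := by
  rw [mem_triangleWord]
  rcases h with ⟨rfl, -⟩ | ⟨rfl, -⟩ <;> unfold second <;> split <;> tauto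

theorem transfer_triangle (ht : AllowedTriple a.level b.level c.level)
    (hw : IsCode (triangleWord u v w z a b c d)) (hw' : IsCode (triangleWord u v w z a b c (!d))) :
    Transfer (triangleWord u v w z a b c d) (triangleWord u v w z a b c (!d))
      (· ∈ u ++ v ++ w ++ z) id (LeavePair a b c d) where
  mem_pair p q h := ⟨h.left_mem, (leavePair_flip h).left_mem⟩
  mem p hp := ⟨mem_triangleWord.2 (Or.inr hp), mem_triangleWord.2 (Or.inr hp)⟩
  forth hfg _ _ _ hφ := exists_triangle_slide hfg ht hw hφ
  back hfg _ _ _ hψ := by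
    obtain ⟨φ, hφ, h, h'⟩ := exists_triangle_slide hfg ht hw' hψ
    -- The inverse of a third move is the third move with the opposite `d`.
    rw [Bool.not_not] at hφ
    exact ⟨φ, hφ, fun p hp => (h p hp).symm, fun p q hpq => (h' q p (leavePair_flip hpq)).symm⟩
  unique_left hfg _ _ _ _ hφ hφ' heq hK := triangle_coloring_unique hfg ht hφ hφ' heq
    (hK _ _ (Or.inl ⟨rfl, rfl⟩)) (hK _ _ (Or.inr ⟨rfl, rfl⟩))
  unique_right hfg _ _ _ _ hφ hφ' heq hK := triangle_coloring_unique hfg ht hφ hφ' heq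
    (hK _ _ (Or.inl ⟨rfl, rfl⟩)) (hK _ _ (Or.inr ⟨rfl, rfl⟩))

end Triangle

theorem Move.exists_transfer.{u} {w w' : List Passage} (h : Move w w') (hw : IsCode w)
    (hw' : IsCode w') : ∃ P σ K, Transfer.{u} w w' P σ K := by
  cases h with
  | rename f hf => exact ⟨_, _, _, transfer_rename hf w⟩
  | kink u v p => exact ⟨_, _, _, transfer_kink hw hw'⟩
  | bigon_parallel u v w p q hlevel hside =>
    exact ⟨_, _, _, transfer_bigon (e := true) hlevel hside hw hw'⟩
  | bigon_antiparallel u v w p q hlevel hside =>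
    exact ⟨_, _, _, transfer_bigon (e := false) hlevel hside hw hw'⟩
  | triangle u v w z a b c d h => exact ⟨_, _, _, transfer_triangle h hw hw'⟩


/-! ### The biquandle of a switch -/

section SwitchAction

open Matrix

variable {R : Type*} [Ring R] {N : Type*} [AddCommGroup N] [Module R N]

/-- The outgoing colour of the under strand. -/
def underOut (S : Matrix (Fin 2) (Fin 2) R) (o u : N) : N := S 0 0 • o + S 0 1 • u

/-- The outgoing colour of the over strand. -/
def overOut (S : Matrix (Fin 2) (Fin 2) R) (o u : N) : N := S 1 0 • o + S 1 1 • u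

/-- The action of a square matrix on columns with entries in a module. -/
def act {n : Type*} [Fintype n] (T : Matrix n n R) (v : n → N) (i : n) : N := ∑ j, T i j • v j

theorem act_mul {n : Type*} [Fintype n] (T T' : Matrix n n R) (v : n → N) :
    act (T * T') v = act T (act T' v) := by
  funext i
  simp only [act, Matrix.mul_apply, Finset.sum_smul, Finset.smul_sum, mul_smul]
  exact Finset.sum_comm

theorem act_one {n : Type*} [Fintype n] [DecidableEq n] (v : n → N) :
    act (1 : Matrix n n R) v = v := by
  funext i
  simp [act, Matrix.one_apply]

variable {S : Matrix (Fin 2) (Fin 2) R}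

theorem act_pair (o u : N) : act S ![o, u] = ![underOut S o u, overOut S o u] := by
  funext i
  fin_cases i <;> simp [act, underOut, overOut, Fin.sum_univ_two]

theorem act_leftFactor (x y z : N) :
    act (leftFactor S) ![x, y, z] = ![underOut S x y, overOut S x y, z] := by
  funext i
  fin_cases i <;> simp [act, leftFactor, underOut, overOut, Fin.sum_univ_three]

theorem act_rightFactor (x y z : N) :
    act (rightFactor S) ![x, y, z] = ![x, underOut S y z, overOut S y z] := by
  funext i
  fin_cases i <;> simp [act, rightFactor, underOut, overOut, Fin.sum_univ_three]

theorem smul_bijective_of_isUnit {r : R} (hr : IsUnit r) :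
    Function.Bijective fun x : N => r • x := by
  obtain ⟨r, rfl⟩ := hr
  exact ⟨fun x y h => by simpa [smul_smul] using congrArg ((↑r⁻¹ : R) • ·) h,
    fun x => ⟨(↑r⁻¹ : R) • x, by simp [smul_smul]⟩⟩

/-- The `(0, 0)` entry of Yang–Baxter reads `A² + BAC = A`. -/
theorem IsSwitch.first_entry (hS : IsSwitch S) :
    S 0 1 * S 0 0 * S 1 0 = S 0 0 * (1 - S 0 0) := by
  have h := congrFun (congrFun hS.yangBaxter 0) 0
  simp [Matrix.mul_apply, Fin.sum_univ_three, leftFactor, rightFactor] at h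
  rw [mul_sub, mul_one]
  exact eq_sub_of_add_eq' h

/-- The `(0, 1)` entry of Yang–Baxter reads `AB + BAD = BA`. -/
theorem IsSwitch.second_entry (hS : IsSwitch S) :
    S 0 1 * S 0 0 * (1 - S 1 1) = S 0 0 * S 0 1 := by
  have h := congrFun (congrFun hS.yangBaxter 0) 1
  simp [Matrix.mul_apply, Fin.sum_univ_three, leftFactor, rightFactor] at h
  rw [mul_sub, mul_one, sub_eq_iff_eq_add]
  exact h.symm

theorem isBiquandle_of_isSwitch (hS : IsSwitch S) (hA : IsUnit (S 0 0))
    (hA' : IsUnit (1 - S 0 0)) (hB : IsUnit (S 0 1)) :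
    IsBiquandle (underOut S : N → N → N) (overOut S) := by
  have hyb : ∀ x y z : N, _ := fun x y z =>
    congrArg (fun T => act T ![x, y, z]) hS.yangBaxter
  simp only [act_mul, act_leftFactor, act_rightFactor] at hyb
  obtain ⟨U, hU⟩ := hS.isUnit
  -- `C = (BA)⁻¹ A (1 - A)` is a product of units.
  have hC : IsUnit (S 1 0) := by
    have h := hS.first_entry
    obtain ⟨r, hr⟩ := hB.mul hA
    rw [← hr] at h
    rw [(Units.eq_inv_mul_iff_mul_eq r).2 h]
    exact r⁻¹.isUnit.mul (hA.mul hA')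
  refine ⟨fun o u o' u' h₁ h₂ => ?_, fun a b => ?_, fun o => ?_, fun u => ?_, fun o u => ?_,
    fun x y z => congrFun (hyb x y z) 0, fun x y z => congrFun (hyb x y z) 1,
    fun x y z => congrFun (hyb x y z) 2⟩
  · have h : act S ![o, u] = act S ![o', u'] := by rw [act_pair, act_pair, h₁, h₂]
    replace h := congrArg (act (↑U⁻¹ : Matrix (Fin 2) (Fin 2) R)) h
    rw [← act_mul, ← act_mul, ← hU, Units.inv_mul, act_one, act_one] at h
    exact ⟨congrFun h 0, congrFun h 1⟩
  · have h : act S (act (↑U⁻¹ : Matrix (Fin 2) (Fin 2) R) ![a, b]) = ![a, b] := by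
      rw [← act_mul, ← hU, Units.mul_inv, act_one]
    have hv : ∀ v : Fin 2 → N, v = ![v 0, v 1] := fun v => by
      funext i
      fin_cases i <;> rfl
    generalize act (↑U⁻¹ : Matrix (Fin 2) (Fin 2) R) ![a, b] = v at h
    rw [hv v, act_pair] at h
    exact ⟨_, _, congrFun h 0, congrFun h 1⟩
  · exact (Equiv.addLeft _).bijective.comp (smul_bijective_of_isUnit hB)
  · exact (Equiv.addRight _).bijective.comp (smul_bijective_of_isUnit hC)
  -- By the two entries, both sides equal `A(1 - A)o - ABu`. Since `BA` and `A` act injectively, one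
  -- difference vanishes exactly when the other does.
  · have h : (S 0 1 * S 0 0) • (overOut S o u - u) = S 0 0 • (o - underOut S o u) := by
      have h₁ : (S 0 1 * S 0 0) • (overOut S o u - u) =
          (S 0 1 * S 0 0 * S 1 0) • o - (S 0 1 * S 0 0 * (1 - S 1 1)) • u := by
        simp only [overOut, smul_sub, smul_add, mul_sub, sub_smul, mul_smul, mul_one]
        abel
      rw [h₁, hS.first_entry, hS.second_entry]
      simp only [underOut, smul_sub, smul_add, mul_sub, sub_smul, mul_smul, mul_one]
      abel
    have h₁ := (smul_bijective_of_isUnit (N := N) (hB.mul hA)).1.eq_iff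
      (a := overOut S o u - u) (b := 0)
    have h₂ := (smul_bijective_of_isUnit (N := N) hA).1.eq_iff (a := o - underOut S o u) (b := 0)
    simp only [smul_zero, sub_eq_zero] at h₁ h₂
    rw [← h₁, h, h₂, eq_comm]

theorem map_underOut {N' : Type*} [AddCommGroup N'] [Module R N'] (ℓ : N →ₗ[R] N') (o u : N) :
    ℓ (underOut S o u) = underOut S (ℓ o) (ℓ u) := by
  simp [underOut]

theorem map_overOut {N' : Type*} [AddCommGroup N'] [Module R N'] (ℓ : N →ₗ[R] N') (o u : N) :
    ℓ (overOut S o u) = overOut S (ℓ o) (ℓ u) := by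
  simp [overOut]

theorem IsColoring.map {N' : Type*} [AddCommGroup N'] [Module R N'] {w : List Passage}
    {φ : Passage → N × N} {a b : N} (h : IsColoring (underOut S) (overOut S) w φ a b)
    (ℓ : N →ₗ[R] N') :
    IsColoring (underOut S) (overOut S) w (fun p => Prod.map ℓ ℓ (φ p)) (ℓ a) (ℓ b) where
  isPath := by
    obtain ⟨e, h₁, h₂, h₃⟩ := isPath_iff_exists_edges.1 h.isPath
    exact isPath_iff_exists_edges.2 ⟨fun i => ℓ (e i), congrArg ℓ h₁, congrArg ℓ h₂,
      fun i hi => by rw [h₃ i hi]; rfl⟩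
  crossing p hp := by
    have := h.crossing p hp
    obtain ⟨k, l, b⟩ := p
    cases l <;> cases b <;> simp only [Crossing, Prod.map] at this ⊢ <;>
      simp [← map_underOut, ← map_overOut, ← this.1, ← this.2]

end SwitchAction

/-! ### The universal colouring -/

section Universal

variable {R : Type*} [Ring R] (S : Matrix (Fin 2) (Fin 2) R) (D : Diagram)

/-- The generator of the module attached to the edge `k`. -/
noncomputable def Diagram.edgeColor (k : ℕ) : D.KnotModule S :=
  D.x S ⟨(D.word.take k).countP Passage.isReal,
    Nat.lt_succ_of_le (List.Sublist.countP_le (List.take_sublist _ _))⟩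

theorem Diagram.edgeColor_zero : D.edgeColor S 0 = D.x S 0 := rfl

theorem Diagram.edgeColor_length : D.edgeColor S D.word.length = D.x S (Fin.last D.n) := by
  unfold edgeColor
  congr 1
  ext
  simp [Diagram.n]

theorem Diagram.mkQ_gen (k : Fin (D.word.length + 1)) :
    (D.relations S).mkQ (D.gen k) = D.edgeColor S k := rfl

theorem countP_take_succ {w : List Passage} {i : ℕ} (hi : i < w.length) :
    (w.take (i + 1)).countP Passage.isReal =
      (w.take i).countP Passage.isReal + if w[i].isReal then 1 else 0 := by
  rw [List.take_add_one, List.countP_append, List.getElem?_eq_getElem hi]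
  simp [List.countP_cons]

theorem exists_countP_take_eq (w : List Passage) (m : ℕ) (hm : m ≤ w.countP Passage.isReal) :
    ∃ k ≤ w.length, (w.take k).countP Passage.isReal = m := by
  induction w generalizing m with
  | nil => exact ⟨0, le_rfl, by simpa [eq_comm] using hm⟩
  | cons p w ih =>
    rcases Nat.eq_zero_or_pos m with rfl | hm'
    · exact ⟨0, by simp, by simp⟩
    · rw [List.countP_cons] at hm
      obtain ⟨k, hk, h⟩ := ih (m - if p.isReal then 1 else 0) (by omega)
      refine ⟨k + 1, by simpa using hk, ?_⟩
      rw [List.take_succ_cons, List.countP_cons, h]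
      split <;> omega

/-- Edges with equal counts are separated by virtual passages only, and these preserve the colour.
-/
theorem eq_of_countP_take_eq {N : Type*} {w : List Passage} {e : ℕ → N}
    (he : ∀ i (hi : i < w.length), w[i].isReal = false → e i = e (i + 1)) {k l : ℕ}
    (hkl : k ≤ l) (hl : l ≤ w.length)
    (h : (w.take k).countP Passage.isReal = (w.take l).countP Passage.isReal) : e k = e l := by
  induction l, hkl using Nat.le_induction with
  | base => rfl
  | succ l hkl ih =>
    have h₁ := countP_take_succ (w := w) (i := l) (by omega)
    have h₂ : (w.take k).countP Passage.isReal ≤ (w.take l).countP Passage.isReal :=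
      (List.take_sublist_take_left hkl).countP_le
    have h₃ : w[l].isReal = false := by
      by_contra hne
      rw [if_pos (by simpa using hne)] at h₁
      omega
    rw [h₃] at h₁
    rw [ih (by omega) (by simp at h₁; omega), he l (by omega) h₃]

theorem IsColoring.edge_relation {N : Type*} {f g : N → N → N} {w : List Passage}
    {φ : Passage → N × N} {a b : N} (h : IsColoring f g w φ a b) {e : ℕ → N}
    (he : ∀ (i : ℕ) (hi : i < w.length), φ w[i] = (e i, e (i + 1))) (i j : Fin w.length)
    (hij : w[j] = w[i].partner) :
    Crossing f g w[i].level w[i].side (e i, e (i + 1)) (e j, e (j + 1)) := by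
  have := h.crossing w[i] (List.getElem_mem _)
  rw [← hij] at this
  simp only [Fin.getElem_fin] at this ⊢
  rwa [he, he] at this

theorem Diagram.exists_universal_coloring : ∃ φ : Passage → D.KnotModule S × D.KnotModule S,
    IsColoring (underOut S) (overOut S) D.word φ (D.x S 0) (D.x S (Fin.last D.n)) ∧
    ∀ (i : ℕ) (hi : i < D.word.length),
      φ D.word[i] = (D.edgeColor S i, D.edgeColor S (i + 1)) := by
  have hinj := List.nodup_iff_injective_get.1 D.isCode.nodup
  let pair : Fin D.word.length → D.KnotModule S × D.KnotModule S :=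
    fun i => (D.edgeColor S i, D.edgeColor S (i + 1))
  -- The passages of a code are distinct, so edge colours define a function on passages; the value
  -- `(0, 0)` off the word is irrelevant.
  have hφ : ∀ i : Fin D.word.length,
      Function.extend D.word.get pair (fun _ => (0, 0)) D.word[i] = pair i :=
    fun i => hinj.extend_apply pair _ i
  generalize Function.extend D.word.get pair (fun _ => (0, 0)) = φ at hφ
  have hrel : ∀ r, D.Relator S r → (D.relations S).mkQ r = 0 := fun r hr =>
    (Submodule.Quotient.mk_eq_zero _).2 (Submodule.subset_span hr)
  have hover : ∀ i j : Fin D.word.length, D.word[j] = D.word[i].partner →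
      D.word[i].level = .over →
      Crossing (underOut S) (overOut S) .over D.word[i].side (φ D.word[i]) (φ D.word[j]) := by
    intro i j hij hl
    rw [hφ, hφ]
    cases hs : D.word[i].side
    · have h₁ := hrel _ (.neg_under i j hij hl hs)
      have h₂ := hrel _ (.neg_over i j hij hl hs)
      simp only [map_sub, map_add, map_smul, mkQ_gen, sub_eq_zero] at h₁ h₂
      exact ⟨h₁.symm, h₂.symm⟩
    · have h₁ := hrel _ (.pos_under i j hij hl hs)
      have h₂ := hrel _ (.pos_over i j hij hl hs)
      simp only [map_sub, map_add, map_smul, mkQ_gen, sub_eq_zero] at h₁ h₂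
      exact ⟨h₁.symm, h₂.symm⟩
  have hvirt : ∀ i : Fin D.word.length, D.word[i].level = .virt →
      (φ D.word[i]).1 = (φ D.word[i]).2 := by
    intro i hl
    rw [hφ]
    simp only [pair, edgeColor]
    congr 2
    rw [countP_take_succ i.2]
    simp only [Fin.getElem_fin] at hl
    simp [Passage.isReal, hl]
  refine ⟨φ, ⟨isPath_iff_exists_edges.2 ⟨D.edgeColor S, rfl, D.edgeColor_length S,
    fun i hi => hφ ⟨i, hi⟩⟩, fun p hp => ?_⟩, fun i hi => hφ ⟨i, hi⟩⟩
  obtain ⟨i, hi, hip⟩ := List.getElem_of_mem hp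
  obtain ⟨j, hj, hjp⟩ := List.getElem_of_mem (D.isCode.partner_mem p hp)
  have hij : D.word[j] = D.word[i].partner := by rw [hip, hjp]
  have hji : D.word[i] = D.word[j].partner := by rw [hij, Passage.partner_partner]
  cases hl : p.level
  · have := hover ⟨i, hi⟩ ⟨j, hj⟩ hij (by simp [hip, hl])
    simpa [hip, hjp] using this
  · have hl' : p.partner.level = .over := by simp [Passage.partner, hl, Level.swap]
    have := hover ⟨j, hj⟩ ⟨i, hi⟩ hji (by simp [hjp, hl'])
    simp only [Fin.getElem_fin, hip, hjp] at this
    exact (crossing_swap .under p.side _ _).1 this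
  · have hl' : p.partner.level = .virt := by simp [Passage.partner, hl, Level.swap]
    have h₁ := hvirt ⟨i, hi⟩ (by simp [hip, hl])
    have h₂ := hvirt ⟨j, hj⟩ (by simp [hjp, hl'])
    simp only [Fin.getElem_fin, hip, hjp] at h₁ h₂
    exact ⟨h₁, h₂⟩

variable {S D} {N : Type*} [AddCommGroup N] [Module R N]

/-- Universality: edge colours are constant on semi-arcs, so they define a map on generators, and
the crossing relations say that it kills the relators. -/
theorem Diagram.exists_linearMap {φ : Passage → N × N} {a b : N}
    (h : IsColoring (underOut S) (overOut S) D.word φ a b) :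
    ∃ ℓ : D.KnotModule S →ₗ[R] N, ℓ (D.x S 0) = a ∧ ℓ (D.x S (Fin.last D.n)) = b ∧
      ∀ (i : ℕ) (hi : i < D.word.length),
        φ D.word[i] = (ℓ (D.edgeColor S i), ℓ (D.edgeColor S (i + 1))) := by
  obtain ⟨e, ha, hb, he⟩ := isPath_iff_exists_edges.1 h.isPath
  -- `s m` is some edge on the semi-arc `m`; by `hconst` the choice does not affect the colour.
  choose s hs hs' using fun m : Fin (D.n + 1) =>
    exists_countP_take_eq D.word m (Nat.le_of_lt_succ m.2)
  have hvirt : ∀ i (hi : i < D.word.length), D.word[i].isReal = false → e i = e (i + 1) := by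
    intro i hi hr
    have := h.crossing D.word[i] (List.getElem_mem _)
    have hl : D.word[i].level = .virt := by
      unfold Passage.isReal at hr
      split at hr
      · assumption
      · cases hr
    rw [hl, he] at this
    exact this.1
  have hconst : ∀ k l, k ≤ D.word.length → l ≤ D.word.length →
      (D.word.take k).countP Passage.isReal = (D.word.take l).countP Passage.isReal →
      e k = e l := by
    intro k l hk hl hkl
    rcases le_total k l with h | h
    · exact eq_of_countP_take_eq hvirt h hl hkl
    · exact (eq_of_countP_take_eq hvirt h hk hkl.symm).symm
  let L : (Fin (D.n + 1) →₀ R) →ₗ[R] N := Finsupp.linearCombination R fun m => e (s m)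
  have hgen : ∀ k : Fin (D.word.length + 1), L (D.gen k) = e k := by
    intro k
    simp only [L, gen, Finsupp.linearCombination_single, one_smul]
    exact hconst _ _ (hs _) (Nat.le_of_lt_succ k.2) (hs' _)
  have hle : D.relations S ≤ LinearMap.ker L := by
    refine Submodule.span_le.2 fun r hr => ?_
    rw [SetLike.mem_coe, LinearMap.mem_ker]
    cases hr with
    | pos_under i j hij hl hb =>
      have := h.edge_relation he i j hij
      rw [hl, hb] at this
      simpa [hgen, sub_eq_zero, underOut, overOut] using this.1.symm
    | pos_over i j hij hl hb =>
      have := h.edge_relation he i j hij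
      rw [hl, hb] at this
      simpa [hgen, sub_eq_zero, underOut, overOut] using this.2.symm
    | neg_under i j hij hl hb =>
      have := h.edge_relation he i j hij
      rw [hl, hb] at this
      simpa [hgen, sub_eq_zero, underOut, overOut] using this.1.symm
    | neg_over i j hij hl hb =>
      have := h.edge_relation he i j hij
      rw [hl, hb] at this
      simpa [hgen, sub_eq_zero, underOut, overOut] using this.2.symm
  have hedge : ∀ k, k ≤ D.word.length →
      (D.relations S).liftQ L hle (D.edgeColor S k) = e k := by
    intro k hk
    have := D.mkQ_gen S ⟨k, Nat.lt_succ_of_le hk⟩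
    rw [← this, Submodule.mkQ_apply, Submodule.liftQ_apply, hgen]
  refine ⟨(D.relations S).liftQ L hle, ?_, ?_, fun i hi => ?_⟩
  · rw [← edgeColor_zero, hedge 0 (Nat.zero_le _), ha]
  · rw [← edgeColor_length, hedge _ le_rfl, hb]
  · rw [he, hedge i hi.le, hedge (i + 1) hi]

/-- Every generator belongs to some edge, and an edge is either the initial one or leaves a passage.
-/
theorem Diagram.linearMap_ext {ℓ ℓ' : D.KnotModule S →ₗ[R] N} (h₀ : ℓ (D.x S 0) = ℓ' (D.x S 0))
    (h : ∀ i < D.word.length, ℓ (D.edgeColor S (i + 1)) = ℓ' (D.edgeColor S (i + 1))) :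
    ℓ = ℓ' := by
  refine Submodule.linearMap_qext _ (Finsupp.lhom_ext' fun m => LinearMap.ext_ring ?_)
  change ℓ (D.x S m) = ℓ' (D.x S m)
  obtain ⟨k, hk, hm⟩ := exists_countP_take_eq D.word m (Nat.le_of_lt_succ m.2)
  have hx : D.x S m = D.edgeColor S k := by
    unfold edgeColor
    congr 1
    ext
    exact hm.symm
  rw [hx]
  cases k with
  | zero => exact h₀
  | succ k => exact h k hk

end Universal

/-! ### Invariance -/

section Invariance

universe u

variable {R : Type u} [Ring R] {S : Matrix (Fin 2) (Fin 2) R}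

/-- The modules of the two diagrams are isomorphic in a way that respects the first and the
last generator. -/
def EndIso (S : Matrix (Fin 2) (Fin 2) R) (D E : Diagram) : Prop :=
  ∃ ℓ : D.KnotModule S ≃ₗ[R] E.KnotModule S,
    ℓ (D.x S 0) = E.x S 0 ∧ ℓ (D.x S (Fin.last D.n)) = E.x S (Fin.last E.n)

theorem endIso_equivalence : Equivalence (EndIso S) where
  refl D := ⟨LinearEquiv.refl _ _, rfl, rfl⟩
  symm := by
    rintro D E ⟨ℓ, h₀, h₁⟩
    exact ⟨ℓ.symm, by rw [← h₀, ℓ.symm_apply_apply], by rw [← h₁, ℓ.symm_apply_apply]⟩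
  trans := by
    rintro D E F ⟨ℓ, h₀, h₁⟩ ⟨ℓ', h₀', h₁'⟩
    exact ⟨ℓ.trans ℓ', by simp [h₀, h₀'], by simp [h₁, h₁']⟩

/-- The universal colouring of each diagram is transferred to the other, giving `α` on `E` and `β`
on `D`; universality turns `β` into `ℓ` and `α` into `m`. -/
theorem endIso_of_transfer
    (hS : ∀ (N : Type u) [AddCommGroup N] [Module R N],
      IsBiquandle (underOut S : N → N → N) (overOut S))
    {D E : Diagram} {P : Passage → Prop} {σ : Passage → Passage} {K : Passage → Passage → Prop}
    (h : Transfer.{u} D.word E.word P σ K) : EndIso S D E := by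
  obtain ⟨φ, hφ, hφ'⟩ := D.exists_universal_coloring S
  obtain ⟨ψ, hψ, hψ'⟩ := E.exists_universal_coloring S
  obtain ⟨α, hα, hαP, hαK⟩ := h.forth (hS _) hφ
  obtain ⟨β, hβ, hβP, hβK⟩ := h.back (hS _) hψ
  obtain ⟨ℓ, hℓ₀, hℓ₁, hℓ⟩ := D.exists_linearMap hβ
  obtain ⟨m, hm₀, hm₁, hm⟩ := E.exists_linearMap hα
  have hℓφ : ∀ p ∈ D.word, Prod.map ℓ ℓ (φ p) = β p := by
    intro p hp
    obtain ⟨i, hi, rfl⟩ := List.getElem_of_mem hp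
    rw [hφ', hℓ]
    rfl
  have hmψ : ∀ p ∈ E.word, Prod.map m m (ψ p) = α p := by
    intro p hp
    obtain ⟨i, hi, rfl⟩ := List.getElem_of_mem hp
    rw [hψ', hm]
    rfl
  -- The image of `φ` under `m ∘ₗ ℓ` is again a colouring of `D` with the same ends. It agrees with
  -- `φ` on all recorded colours, since these pass unchanged from `φ` to `α` and from `ψ` to `β`;
  -- uniqueness does the rest.
  have h₁ : m ∘ₗ ℓ = LinearMap.id := by
    have hc := (hφ.map ℓ).map m
    rw [hℓ₀, hℓ₁, hm₀, hm₁] at hc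
    have key := h.unique_left (hS _) hc hφ (fun p hp => ?_) (fun p q hpq => ?_)
    · refine Diagram.linearMap_ext (by simp [hℓ₀, hm₀]) fun i hi => ?_
      have := key _ (List.getElem_mem hi)
      rw [hφ'] at this
      exact congrArg Prod.snd this
    · rw [hℓφ p (h.mem p hp).1, ← hβP p hp, hmψ _ (h.mem p hp).2, hαP p hp]
    · rw [hℓφ p (h.mem_pair p q hpq).1, ← hαK p q hpq, ← hmψ q (h.mem_pair p q hpq).2]
      simp [hβK p q hpq]
  have h₂ : ℓ ∘ₗ m = LinearMap.id := by
    have hc := (hψ.map m).map ℓ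
    rw [hm₀, hm₁, hℓ₀, hℓ₁] at hc
    have key := h.unique_right (hS _) hc hψ (fun p hp => ?_) (fun p q hpq => ?_)
    · refine Diagram.linearMap_ext (by simp [hℓ₀, hm₀]) fun i hi => ?_
      have := key _ (List.getElem_mem hi)
      rw [hψ'] at this
      exact congrArg Prod.snd this
    · rw [hmψ _ (h.mem p hp).2, hαP p hp, hℓφ p (h.mem p hp).1, hβP p hp]
    · rw [hmψ q (h.mem_pair p q hpq).2, hβK p q hpq, ← hℓφ p (h.mem_pair p q hpq).1]
      simp [hαK p q hpq]
  exact ⟨LinearEquiv.ofLinearMap ℓ m h₂ h₁, hℓ₀, hℓ₁⟩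

theorem EndIso.of_equivalent
    (hS : ∀ (N : Type u) [AddCommGroup N] [Module R N],
      IsBiquandle (underOut S : N → N → N) (overOut S))
    {D E : Diagram} (h : D.Equivalent E) : EndIso S D E := by
  refine endIso_equivalence.eqvGen_iff.1 (Relation.EqvGen.mono (fun D E hDE => ?_) _ _ h)
  obtain ⟨P, σ, K, ht⟩ := Move.exists_transfer hDE D.isCode E.isCode
  exact endIso_of_transfer hS ht

end Invariance

end LongVirtual


theorem theorem3p1 {R : Type*} [Ring R] (S : Matrix (Fin 2) (Fin 2) R)
    (hS : LongVirtual.IsSwitch S)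
    (hA : IsUnit (S 0 0)) (hA' : IsUnit (1 - S 0 0)) (hB : IsUnit (S 0 1))
    (D E : LongVirtual.Diagram) (hDE : D.Equivalent E) :
    Nonempty (D.KnotModule S ≃ₗ[R] E.KnotModule S) ∧
    Nonempty (D.ClosureModule S ≃ₗ[R] E.ClosureModule S) ∧
    Nonempty (D.InputModule S ≃ₗ[R] E.InputModule S) ∧
    Nonempty (D.OutputModule S ≃ₗ[R] E.OutputModule S) := by
  obtain ⟨ℓ, h₀, h₁⟩ := LongVirtual.EndIso.of_equivalent
    (fun N _ _ => LongVirtual.isBiquandle_of_isSwitch hS hA hA' hB) hDE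
  -- Each extra relator is built from the end generators, which `ℓ` matches, so its span is carried
  -- onto the corresponding span.
  refine ⟨⟨ℓ⟩, ⟨Submodule.Quotient.equiv _ _ ℓ ?_⟩, ⟨Submodule.Quotient.equiv _ _ ℓ ?_⟩,
    ⟨Submodule.Quotient.equiv _ _ ℓ ?_⟩⟩ <;>
  simp [Submodule.map_span, h₀, h₁]
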